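/- Let $\Sigma_*\in\mathbb R^{d\times d}$ be a symmetric positive definite matrix with $\Sigma_*^{-1}=P\,\mathrm{diag}(s_1,\dots,s_d)\,P^T$, where $P$ is orthogonal and $s_1\ge s_2\ge\dots\ge s_d>0$. Put $f(x)=\frac12x^T\Sigma_*^{-1}x$ and $\kappa=s_1/s_d$. Assume $s_1>1>s_d$ and $\sqrt{s_1}-\sqrt{s_d}\ge 2$, and set $$a=1,\qquad \gamma=s_d+2\sqrt{s_d},\qquad h=\frac1{5s_1}.$$ Let $(x_0,p_0)\sim\mathcal N(0,I_{2d})$ and let $(x_k,p_k)_{k\ge0}$ be the Euler–Maruyama discretization with step size $h$ of the gradient-adjusted underdamped Langevin dynamics (GAUL), that is, $$x_{k+1}=x_k-ah\nabla f(x_k)+hp_k+\sqrt{2ah}\,z_k^{(1)},\qquad p_{k+1}=p_k-h\nabla f(x_k)-\gamma hp_k+\sqrt{2\gamma h}\,z_k^{(2)},$$ where the $z_k^{(1)},z_k^{(2)}\sim\mathcal N(0,I_d)$ ($k\ge0$) are mutually independent and independent of $(x_0,p_0)$. Let $\nu_k$ be the law of $x_k$ (so $\nu_0=\mathcal N(0,I_d)$),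 and let $\tilde\pi=\mathcal N\big(0,\,P\,\mathrm{diag}(Y_1,\dots,Y_d)\,P^T\big)$ with $$Y_i=\frac1{s_i}\left(1-\frac{hs_i\big(4+(h+a(h\gamma-2))(hs_i-\gamma+as_i(h\gamma-1))\big)}{(hs_i-\gamma+as_i(h\gamma-1))\big(4+h(hs_i-2\gamma+as_i(h\gamma-2))\big)}\right).$$ Then $Y_i>0$ for all $i$, and $\mathrm{TV}(\nu_k,\tilde\pi)\to0$ as $k\to\infty$, where $\mathrm{TV}(\mu,\nu)=\sup_A|\mu(A)-\nu(A)|$ over Borel sets $A$. Moreover, for every $\delta\in(0,1)$ the mixing time $t_{\mathrm{mix}}(\delta)=\min\{k\ge0:\mathrm{TV}(\nu_k,\tilde\pi)\le\delta\}$ exists and satisfies $$t_{\mathrm{mix}}(\delta)\le C\,\frac{\log\kappa+\log(1/\delta)+\log d}{\frac1\kappa+\frac1{\sqrt{\kappa s_1}}},$$ where $C>0$ is an absolute constant, independent of $d$, $\Sigma_*$ and $\delta$. -/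

import Mathlib

open MeasureTheory ProbabilityTheory Filter Topology
open scoped Matrix Gradient

noncomputable section

/-- Total variation distance of two (probability) measures:
the supremum of `|P(A) - Q(A)|` over all measurable sets `A`. -/
def tvDist {Ω : Type*} [MeasurableSpace Ω] (P Q : Measure Ω) : ℝ :=
  ⨆ A : {A : Set Ω // MeasurableSet A}, |P.real A.1 - Q.real A.1|

/-- `N` is the discrete `δ`-mixing time of the sequence of laws `μ` towards `ν`:
the minimum of all `k` with `TV(μ k, ν) ≤ δ`. -/
def IsDiscreteMixingTime {Ω : Type*} [MeasurableSpace Ω] (μ : ℕ → Measure Ω) (ν : Measure Ω)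
    (δ : ℝ) (N : ℕ) : Prop :=
  IsLeast {k : ℕ | tvDist (μ k) ν ≤ δ} N

/-- The quadratic potential `f(x) = xᵀ S⁻¹ x / 2`, where `S` is the covariance matrix. -/
def quadPotential {d : ℕ} (S : Matrix (Fin d) (Fin d) ℝ) (x : EuclideanSpace ℝ (Fin d)) : ℝ :=
  (1 / 2) * (x.ofLp ⬝ᵥ (S⁻¹ *ᵥ x.ofLp))

/-- One Euler--Maruyama step of size `h`, with the Gaussian noise `(z₁, z₂)`, of the
gradient-adjusted underdamped Langevin dynamics
`dx = (-a ∇f(x) + p) dt + √(2a) dB¹`, `dp = (-∇f(x) - γ p) dt + √(2γ) dB²`. -/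
def gaulUpdate {d : ℕ} (f : EuclideanSpace ℝ (Fin d) → ℝ) (a γ h : ℝ)
    (X z : EuclideanSpace ℝ (Fin d) × EuclideanSpace ℝ (Fin d)) :
    EuclideanSpace ℝ (Fin d) × EuclideanSpace ℝ (Fin d) :=
  (X.1 - (a * h) • ∇ f X.1 + h • X.2 + √(2 * a * h) • z.1,
   X.2 - h • ∇ f X.1 - (γ * h) • X.2 + √(2 * γ * h) • z.2)

/-- The operator on laws of `(x, p)` induced by one Euler--Maruyama step, with fresh noise
`z ∼ N(0, I)` in dimension `2d`, independent of the current state. -/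
def gaulOperator {d : ℕ} (f : EuclideanSpace ℝ (Fin d) → ℝ) (a γ h : ℝ)
    (ν : Measure (EuclideanSpace ℝ (Fin d) × EuclideanSpace ℝ (Fin d))) :
    Measure (EuclideanSpace ℝ (Fin d) × EuclideanSpace ℝ (Fin d)) :=
  (ν.prod ((stdGaussian (EuclideanSpace ℝ (Fin d))).prod
    (stdGaussian (EuclideanSpace ℝ (Fin d))))).map (fun w => gaulUpdate f a γ h w.1 w.2)

/-- The law of the position `x` after `k` Euler--Maruyama steps started from
`(x₀, p₀) ∼ N(0, I)` in dimension `2d`. -/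
def gaulPositionLaw {d : ℕ} (f : EuclideanSpace ℝ (Fin d) → ℝ) (a γ h : ℝ) (k : ℕ) :
    Measure (EuclideanSpace ℝ (Fin d)) :=
  (((gaulOperator f a γ h)^[k]) ((stdGaussian (EuclideanSpace ℝ (Fin d))).prod
    (stdGaussian (EuclideanSpace ℝ (Fin d))))).map Prod.fst

/-- The variance of the biased target along an eigenvector of the precision matrix `S⁻¹`
with eigenvalue `s`. -/
def biasedVariance (a γ h s : ℝ) : ℝ :=
  (1 / s) * (1 - (h * s * (4 + (h + a * (h * γ - 2)) * (h * s - γ + a * s * (h * γ - 1)))) /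
    ((h * s - γ + a * s * (h * γ - 1)) *
      (4 + h * (h * s - 2 * γ + a * s * (h * γ - 2)))))

/-- The covariance matrix of the biased target, when the precision matrix is
`P * diagonal s * Pᵀ` with `P` orthogonal. -/
def biasedCovariance {d : ℕ} (P : Matrix (Fin d) (Fin d) ℝ) (s : Fin d → ℝ) (a γ h : ℝ) :
    Matrix (Fin d) (Fin d) ℝ :=
  P * Matrix.diagonal (fun i => biasedVariance a γ h (s i)) * Pᵀ

end

/-!
In the basis given by the columns of `P` the dynamics splits into `d` independent planar linear
recursions, one for each eigenvalue `s` of the precision matrix. In each plane the covariance of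
(position, momentum) obeys `Σ ↦ A Σ Aᵀ + D` with `A = stepMatrix` and `D` the covariance of the
noise, so the law of the position is a centred Gaussian with covariance `P * diagonal V * Pᵀ`, where
`V i` is the position entry of `covarianceSeq` (`gaulPositionLaw_eq`, proved with characteristic
functions). The recursion has an explicit fixed point `stationaryCovariance`, whose position entry
is `biasedVariance`, and the deviation from it is `A ^ k (1 - F) (A ^ k)ᵀ`.

The friction makes the slowest direction, with eigenvalue `sd = t ^ 2`, critically damped. All
eigenvalues of all the matrices `A` then lie in the disc of radius `1 - h t / 4`, by the Jury
criterion. Since `A` may have a double eigenvalue, powers are bounded through the second-order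
recurrence that Cayley--Hamilton gives (`abs_pow_apply_le`); the additional factor `k` is absorbed
into the rate. Hence the variances converge geometrically with relative error at most a polynomial
in `κ` times `exp (-(h t / 4) k)` (`CriticalDamping.abs_covarianceSeq_sub_le`).

Two centred Gaussians with a common eigenbasis and relative variance error `η` have total variation
distance at most `8 d η` (`tvDist_multivariateGaussian_le`): the Gaussian with the smaller variance
in each direction has density at most `(1 + 2 η) ^ d` with respect to both of them. Polynomial
prefactors in `κ` and `d` only enter the mixing time through their logarithms, and
`1 / (h t) = 5 s₁ / t` is comparable to `(1 / κ + 1 / √(κ s₁))⁻¹` because `t < 1`.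
-/

open scoped RealInnerProductSpace NNReal

/-! ### Powers of a two-by-two matrix -/

/-- The Schur--Cohn (Jury) criterion: under these two inequalities the roots of
`z ^ 2 - τ z + Δ` lie in the closed disc of radius `ρ`. -/
lemma exists_roots_norm_le {τ Δ ρ : ℝ} (hρ : 0 < ρ) (h1 : Δ ≤ ρ ^ 2)
    (h2 : |τ| * ρ ≤ ρ ^ 2 + Δ) :
    ∃ r₁ r₂ : ℂ, r₁ + r₂ = τ ∧ r₁ * r₂ = Δ ∧ ‖r₁‖ ≤ ρ ∧ ‖r₂‖ ≤ ρ := by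
  rcases le_total (4 * Δ) (τ ^ 2) with hd | hd
  · set w := √(τ ^ 2 - 4 * Δ) with hw
    have hw2 : w ^ 2 = τ ^ 2 - 4 * Δ := Real.sq_sqrt (by linarith)
    have hw0 : 0 ≤ w := Real.sqrt_nonneg _
    have hτ : |τ| ≤ 2 * ρ := by
      by_contra! hcon
      nlinarith
    have hwle : w ≤ 2 * ρ - |τ| := by
      apply Real.sqrt_le_iff.2 ⟨by linarith, ?_⟩
      nlinarith [sq_abs τ]
    have hwC : (w : ℂ) ^ 2 = (τ : ℂ) ^ 2 - 4 * Δ := by exact_mod_cast hw2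
    have hτ1 := le_abs_self τ
    have hτ2 := neg_abs_le τ
    refine ⟨(((τ + w) / 2 : ℝ) : ℂ), (((τ - w) / 2 : ℝ) : ℂ), ?_, ?_, ?_, ?_⟩
    · push_cast; ring
    · push_cast; linear_combination (-1 / 4 : ℂ) * hwC
    · rw [Complex.norm_real, Real.norm_eq_abs, abs_le]
      constructor <;> linarith
    · rw [Complex.norm_real, Real.norm_eq_abs, abs_le]
      constructor <;> linarith
  · set w := √(4 * Δ - τ ^ 2) with hw
    have hw2 : w ^ 2 = 4 * Δ - τ ^ 2 := Real.sq_sqrt (by linarith)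
    have hn : ∀ y : ℝ, y ^ 2 = w ^ 2 → ‖(⟨τ / 2, y / 2⟩ : ℂ)‖ ≤ ρ := by
      intro y hy
      rw [Complex.norm_def]
      apply Real.sqrt_le_iff.2 ⟨hρ.le, ?_⟩
      rw [Complex.normSq_mk]
      nlinarith
    refine ⟨⟨τ / 2, w / 2⟩, ⟨τ / 2, -w / 2⟩, ?_, ?_, hn w rfl, hn (-w) (by ring)⟩
    · apply Complex.ext
      · simp
      · simp; ring
    · apply Complex.ext
      · simp; nlinarith
      · simp; ring

/-- A solution of a second-order linear recurrence grows at most like `k * ρ ^ k` when both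
characteristic roots have modulus at most `ρ`. The factor `k` accounts for a double root. -/
lemma abs_le_of_linear_recurrence {x : ℕ → ℝ} {τ Δ ρ : ℝ} {r₁ r₂ : ℂ}
    (hx : ∀ k, x (k + 2) = τ * x (k + 1) - Δ * x k) (hs : r₁ + r₂ = τ) (hp : r₁ * r₂ = Δ)
    (h1 : ‖r₁‖ ≤ ρ) (h2 : ‖r₂‖ ≤ ρ) (k : ℕ) :
    ρ * |x k| ≤ ρ ^ k * (ρ * |x 0| + k * (|x 1| + ρ * |x 0|)) := by
  have hρ : 0 ≤ ρ := (norm_nonneg _).trans h1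
  -- `x (k + 1) - r₂ * x k` is a geometric sequence of ratio `r₁`
  have hw : ∀ k, (x (k + 1) : ℂ) - r₂ * x k = r₁ ^ k * (x 1 - r₂ * x 0) := by
    intro k
    induction k with
    | zero => simp
    | succ k ih =>
      have hk : (x (k + 1 + 1) : ℂ) = τ * x (k + 1) - Δ * x k := by
        rw [hx k]; push_cast; ring
      rw [pow_succ', mul_assoc, ← ih, hk, ← hs, ← hp]
      ring
  have hw0 : ‖(x 1 : ℂ) - r₂ * x 0‖ ≤ |x 1| + ρ * |x 0| := by
    refine (norm_sub_le _ _).trans ?_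
    rw [norm_mul, Complex.norm_real, Complex.norm_real, Real.norm_eq_abs, Real.norm_eq_abs]
    gcongr
  induction k with
  | zero => simp
  | succ k ih =>
    have h3 : |x (k + 1)| ≤ ρ * |x k| + ρ ^ k * (|x 1| + ρ * |x 0|) := by
      have : (x (k + 1) : ℂ) = r₂ * x k + r₁ ^ k * (x 1 - r₂ * x 0) := by
        rw [← hw k]; ring
      rw [← Real.norm_eq_abs, ← Complex.norm_real, this]
      refine (norm_add_le _ _).trans ?_
      rw [norm_mul, norm_mul, norm_pow, Complex.norm_real, Real.norm_eq_abs]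
      gcongr
    calc ρ * |x (k + 1)| ≤ ρ * (ρ * |x k| + ρ ^ k * (|x 1| + ρ * |x 0|)) := by gcongr
      _ ≤ ρ * (ρ ^ k * (ρ * |x 0| + k * (|x 1| + ρ * |x 0|)) + ρ ^ k * (|x 1| + ρ * |x 0|)) := by
        gcongr
      _ = _ := by push_cast; ring

/-- Entries of the powers of a contracting two-by-two matrix: by Cayley--Hamilton each of them
satisfies a second-order linear recurrence. -/
lemma abs_pow_apply_le {A : Matrix (Fin 2) (Fin 2) ℝ} {ρ : ℝ} (hρ : 1 / 2 ≤ ρ) (hρ1 : ρ ≤ 1)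
    (h1 : A.det ≤ ρ ^ 2) (h2 : |A.trace| * ρ ≤ ρ ^ 2 + A.det) (hA : ∀ i j, |A i j| ≤ 1)
    (k : ℕ) (i j : Fin 2) : |(A ^ k) i j| ≤ 4 * (1 + k) * ρ ^ k := by
  obtain ⟨r₁, r₂, hs, hp, hr1, hr2⟩ := exists_roots_norm_le (by linarith) h1 h2
  have hCH : A ^ 2 = A.trace • A - A.det • 1 := by
    ext i j
    fin_cases i <;> fin_cases j <;>
      simp [sq, Matrix.mul_apply, Fin.sum_univ_two, Matrix.det_fin_two, Matrix.trace_fin_two] <;>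
      ring
  have hrec : ∀ k, (A ^ (k + 2)) i j = A.trace * (A ^ (k + 1)) i j - A.det * (A ^ k) i j := by
    intro k
    rw [pow_add, hCH, mul_sub, Matrix.mul_smul, Matrix.mul_smul, mul_one, ← pow_succ]
    simp
  have h := abs_le_of_linear_recurrence (x := fun k => (A ^ k) i j) hrec hs hp hr1 hr2 k
  have h0 : |(A ^ 0) i j| ≤ 1 := by
    rw [pow_zero, Matrix.one_apply]; split_ifs <;> simp
  have h1' : |(A ^ 1) i j| ≤ 1 := by rw [pow_one]; exact hA i j
  have hk : (0 : ℝ) ≤ k := k.cast_nonneg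
  have h3 : ρ * |(A ^ 0) i j| ≤ 1 := by nlinarith [abs_nonneg ((A ^ 0) i j)]
  have h4 : ρ * |(A ^ k) i j| ≤ ρ ^ k * (1 + k * (1 + 1)) := by
    refine h.trans ?_
    gcongr
  have h5 : 0 ≤ ρ ^ k := by positivity
  nlinarith [abs_nonneg ((A ^ k) i j), mul_nonneg h5 hk]

/-! ### The covariance recursion along one eigenvector -/

/-- The linear part of one step, in the plane spanned by position and momentum along an
eigenvector of the precision matrix with eigenvalue `s`. -/
noncomputable def stepMatrix (a γ h s : ℝ) : Matrix (Fin 2) (Fin 2) ℝ :=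
  !![1 - a * h * s, h; -(h * s), 1 - γ * h]

/-- The covariance after `k` steps of the pair (position, momentum) along an eigenvector of the
precision matrix with eigenvalue `s`, started from the identity. -/
noncomputable def covarianceSeq (a γ h s : ℝ) : ℕ → Matrix (Fin 2) (Fin 2) ℝ
  | 0 => 1
  | k + 1 => stepMatrix a γ h s * covarianceSeq a γ h s k * (stepMatrix a γ h s)ᵀ +
      !![2 * a * h, 0; 0, 2 * γ * h]

lemma covarianceSeq_sub_eq {a γ h s : ℝ} {F : Matrix (Fin 2) (Fin 2) ℝ}
    (hF : stepMatrix a γ h s * F * (stepMatrix a γ h s)ᵀ + !![2 * a * h, 0; 0, 2 * γ * h] = F)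
    (k : ℕ) :
    covarianceSeq a γ h s k - F =
      stepMatrix a γ h s ^ k * (1 - F) * (stepMatrix a γ h s ^ k)ᵀ := by
  induction k with
  | zero => simp [covarianceSeq]
  | succ k ih =>
    have h1 : covarianceSeq a γ h s (k + 1) - F =
        stepMatrix a γ h s * (covarianceSeq a γ h s k - F) * (stepMatrix a γ h s)ᵀ := by
      conv_lhs => rw [← hF]
      rw [covarianceSeq, mul_sub, sub_mul]
      abel
    rw [h1, ih, pow_succ', Matrix.transpose_mul]
    simp only [mul_assoc]

/-- The denominators of the stationary covariance: `1 - det A = h * stationaryDenomFst`. -/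
noncomputable def stationaryDenomFst (γ h s : ℝ) : ℝ := s + γ - h * s * (1 + γ)

/-- The second factor in the denominators of the stationary covariance,
`1 + tr A + det A`. -/
noncomputable def stationaryDenomSnd (γ h s : ℝ) : ℝ :=
  4 - 2 * h * (s + γ) + h ^ 2 * s * (1 + γ)

/-- The covariance fixed by the recursion when `a = 1`; its position entry is `biasedVariance`. -/
noncomputable def stationaryCovariance (γ h s : ℝ) : Matrix (Fin 2) (Fin 2) ℝ :=
  let T := stationaryDenomFst γ h s
  let U := stationaryDenomSnd γ h s
  !![1 / s + h * (4 + (2 - h * (1 + γ)) * T) / (T * U), 2 * h * (s - γ) / (T * U);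
    2 * h * (s - γ) / (T * U),
    1 + h * (2 * γ ^ 2 + 4 * s + 2 * s * γ - 3 * h * s * γ * (1 + γ) - h * s ^ 2 * (1 + γ) +
      h ^ 2 * s ^ 2 * (1 + γ) ^ 2) / (T * U)]

lemma stepMatrix_mul_mul_transpose_add (γ h s y b w : ℝ) :
    stepMatrix 1 γ h s * !![y, b; b, w] * (stepMatrix 1 γ h s)ᵀ +
      !![2 * 1 * h, 0; 0, 2 * γ * h] =
    !![(1 - h * s) ^ 2 * y + 2 * (1 - h * s) * h * b + h ^ 2 * w + 2 * h,
       -(h * s) * (1 - h * s) * y + ((1 - h * s) * (1 - γ * h) - h ^ 2 * s) * b +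
        h * (1 - γ * h) * w;
       -(h * s) * (1 - h * s) * y + ((1 - h * s) * (1 - γ * h) - h ^ 2 * s) * b +
        h * (1 - γ * h) * w,
       (h * s) ^ 2 * y - 2 * (h * s) * (1 - γ * h) * b + (1 - γ * h) ^ 2 * w + 2 * γ * h] := by
  ext i j
  fin_cases i <;> fin_cases j <;>
    simp [stepMatrix, Matrix.vecMul, dotProduct, Fin.sum_univ_two] <;> ring

lemma stationaryCovariance_fixed {γ h s : ℝ} (hs : s ≠ 0) (hT : stationaryDenomFst γ h s ≠ 0)
    (hU : stationaryDenomSnd γ h s ≠ 0) :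
    stepMatrix 1 γ h s * stationaryCovariance γ h s * (stepMatrix 1 γ h s)ᵀ +
      !![2 * 1 * h, 0; 0, 2 * γ * h] = stationaryCovariance γ h s := by
  simp only [stationaryCovariance]
  rw [stepMatrix_mul_mul_transpose_add]
  have h12 : -(h * s) * (1 - h * s) * (1 / s + h * (4 + (2 - h * (1 + γ)) *
        stationaryDenomFst γ h s) / (stationaryDenomFst γ h s * stationaryDenomSnd γ h s)) +
      ((1 - h * s) * (1 - γ * h) - h ^ 2 * s) *
        (2 * h * (s - γ) / (stationaryDenomFst γ h s * stationaryDenomSnd γ h s)) +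
      h * (1 - γ * h) * (1 + h * (2 * γ ^ 2 + 4 * s + 2 * s * γ - 3 * h * s * γ * (1 + γ) -
        h * s ^ 2 * (1 + γ) + h ^ 2 * s ^ 2 * (1 + γ) ^ 2) /
          (stationaryDenomFst γ h s * stationaryDenomSnd γ h s)) =
      2 * h * (s - γ) / (stationaryDenomFst γ h s * stationaryDenomSnd γ h s) := by
    field_simp
    simp only [stationaryDenomFst, stationaryDenomSnd]
    ring
  rw [h12]
  have hcongr : ∀ {a a' b c c' : ℝ}, a = a' → c = c' → !![a, b; b, c] = !![a', b; b, c'] := by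
    rintro _ _ _ _ _ rfl rfl; rfl
  apply hcongr
  · field_simp
    simp only [stationaryDenomFst, stationaryDenomSnd]
    ring
  · field_simp
    simp only [stationaryDenomFst, stationaryDenomSnd]
    ring

lemma biasedVariance_eq {γ h s : ℝ} (hs : s ≠ 0) (hT : stationaryDenomFst γ h s ≠ 0)
    (hU : stationaryDenomSnd γ h s ≠ 0) :
    biasedVariance 1 γ h s = stationaryCovariance γ h s 0 0 := by
  have e1 : h * s - γ + 1 * s * (h * γ - 1) = -stationaryDenomFst γ h s := by
    unfold stationaryDenomFst; ring
  have e2 : 4 + h * (h * s - 2 * γ + 1 * s * (h * γ - 2)) = stationaryDenomSnd γ h s := by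
    unfold stationaryDenomSnd; ring
  rw [biasedVariance, e1, e2]
  simp only [stationaryCovariance, Matrix.of_apply, Matrix.cons_val', Matrix.cons_val_zero]
  field_simp
  ring

/-! ### Contraction at critical damping -/

/-- The choice of parameters along one eigenvector: `t ^ 2` is the smallest eigenvalue of the
precision matrix, `s₁` the largest one and `s` the current one. The friction `γ` makes the
direction `s = t ^ 2` critically damped. -/
structure CriticalDamping (t s₁ s γ h : ℝ) : Prop where
  pos : 0 < t
  lt_one : t < 1
  four_le : 4 ≤ s₁
  sq_le : t ^ 2 ≤ s
  le : s ≤ s₁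
  friction : γ = t ^ 2 + 2 * t
  step : h = 1 / (5 * s₁)

namespace CriticalDamping

variable {t s₁ s γ h : ℝ}

lemma s_pos (H : CriticalDamping t s₁ s γ h) : 0 < s :=
  (pow_pos H.pos 2).trans_le H.sq_le

lemma step_pos (H : CriticalDamping t s₁ s γ h) : 0 < h := by
  have := H.four_le
  rw [H.step]; positivity

lemma step_mul_le (H : CriticalDamping t s₁ s γ h) : h * s ≤ 1 / 5 := by
  have h1 := H.four_le
  have h2 := H.le
  rw [H.step, div_mul_eq_mul_div, div_le_div_iff₀ (by positivity) (by norm_num)]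
  linarith

lemma step_le (H : CriticalDamping t s₁ s γ h) : h ≤ 1 / 20 := by
  have h1 := H.four_le
  rw [H.step, div_le_div_iff₀ (by positivity) (by norm_num)]
  linarith

lemma two_mul_le_friction (H : CriticalDamping t s₁ s γ h) : 2 * t ≤ γ := by
  rw [H.friction]; nlinarith [H.pos]

lemma friction_le (H : CriticalDamping t s₁ s γ h) : γ ≤ 3 := by
  rw [H.friction]; nlinarith [H.pos, H.lt_one]

lemma friction_pos (H : CriticalDamping t s₁ s γ h) : 0 < γ := by
  linarith [H.two_mul_le_friction, H.pos]

lemma step_mul_friction_le (H : CriticalDamping t s₁ s γ h) : h * γ ≤ 3 / 20 := by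
  nlinarith [H.step_le, H.step_pos, H.friction_le, H.friction_pos]

lemma two_mul_le_stationaryDenomFst (H : CriticalDamping t s₁ s γ h) :
    2 * t ≤ stationaryDenomFst γ h s := by
  have h1 := H.two_mul_le_friction
  have h2 := H.step_le
  have h3 := H.step_mul_friction_le
  have h4 : s * (h + h * γ) ≤ s * 1 := mul_le_mul_of_nonneg_left (by linarith) H.s_pos.le
  unfold stationaryDenomFst
  linarith

lemma three_le_stationaryDenomSnd (H : CriticalDamping t s₁ s γ h) :
    3 ≤ stationaryDenomSnd γ h s := by
  have h1 := H.step_mul_le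
  have h2 := H.step_mul_friction_le
  have h3 : 0 ≤ h ^ 2 * s * (1 + γ) := by
    have := H.s_pos; have := H.friction_pos; positivity
  unfold stationaryDenomSnd
  linarith

lemma stationaryDenomFst_pos (H : CriticalDamping t s₁ s γ h) : 0 < stationaryDenomFst γ h s := by
  linarith [H.two_mul_le_stationaryDenomFst, H.pos]

lemma stationaryDenomSnd_pos (H : CriticalDamping t s₁ s γ h) : 0 < stationaryDenomSnd γ h s := by
  linarith [H.three_le_stationaryDenomSnd]

lemma det_stepMatrix (γ h s : ℝ) :
    (stepMatrix 1 γ h s).det = 1 - h * (s + γ) + h ^ 2 * s * (1 + γ) := by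
  rw [stepMatrix, Matrix.det_fin_two_of]; ring

lemma trace_stepMatrix (γ h s : ℝ) : (stepMatrix 1 γ h s).trace = 2 - h * (s + γ) := by
  rw [stepMatrix, Matrix.trace_fin_two_of]; ring

/-- Uniformly over the spectrum, a step contracts at rate `1 - h * t / 4`. -/
lemma abs_stepMatrix_pow_le (H : CriticalDamping t s₁ s γ h) (k : ℕ) (i j : Fin 2) :
    |(stepMatrix 1 γ h s ^ k) i j| ≤ 4 * (1 + k) * (1 - h * t / 4) ^ k := by
  have ht := H.pos
  have ht1 := H.lt_one
  have hh := H.step_pos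
  have hhs := H.step_mul_le
  have hh1 := H.step_le
  have hhγ := H.step_mul_friction_le
  have hs := H.s_pos
  have hγ := H.friction_pos
  have hγ3 := H.friction_le
  have hγt := H.two_mul_le_friction
  have hht : h * t ≤ 1 / 20 := by nlinarith
  have hht0 : 0 < h * t := mul_pos hh ht
  have hhs0 : 0 < h * s := mul_pos hh hs
  have hhγ0 : 0 < h * γ := mul_pos hh hγ
  apply abs_pow_apply_le
  · linarith
  · linarith
  · rw [det_stepMatrix]
    have h1 : h * s * (h * (1 + γ)) ≤ h * s * 1 :=
      mul_le_mul_of_nonneg_left (by linarith) hhs0.le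
    have h2 : h * (2 * t) ≤ h * γ := mul_le_mul_of_nonneg_left hγt hh.le
    nlinarith [sq_nonneg (h * t)]
  · rw [det_stepMatrix, trace_stepMatrix, abs_of_nonneg (by linarith)]
    -- this is the nonnegativity of the characteristic polynomial at `1 - h * t / 4`
    have h1 : γ * t ≤ 3 * s := by
      rw [H.friction]; nlinarith [H.sq_le]
    have h2 : s * t ≤ s := by nlinarith
    have h3 : 0 ≤ h ^ 2 * (s * (1 + γ) - t * (s + γ) / 4) := by
      apply mul_nonneg (by positivity)
      nlinarith [mul_pos hs hγ]
    nlinarith [sq_nonneg (h * t)]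
  · intro i j
    fin_cases i <;> fin_cases j <;> simp [stepMatrix, -abs_mul] <;> rw [abs_le] <;>
      constructor <;> linarith

/-- The closed form of `biasedVariance` is well defined: neither denominator vanishes. -/
lemma biasedVariance_eq_stationaryCovariance (H : CriticalDamping t s₁ s γ h) :
    biasedVariance 1 γ h s = stationaryCovariance γ h s 0 0 :=
  biasedVariance_eq H.s_pos.ne' H.stationaryDenomFst_pos.ne' H.stationaryDenomSnd_pos.ne'

lemma inv_le_biasedVariance (H : CriticalDamping t s₁ s γ h) :
    1 / s ≤ biasedVariance 1 γ h s := by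
  have h1 := H.step_le
  have h2 := H.step_mul_friction_le
  have h3 := H.step_pos
  have h4 := H.stationaryDenomFst_pos
  have h5 := H.stationaryDenomSnd_pos
  rw [H.biasedVariance_eq_stationaryCovariance]
  simp only [stationaryCovariance, Matrix.of_apply, Matrix.cons_val', Matrix.cons_val_zero]
  have h6 : 0 ≤ (2 - h * (1 + γ)) * stationaryDenomFst γ h s :=
    mul_nonneg (by linarith) h4.le
  have : 0 ≤ h * (4 + (2 - h * (1 + γ)) * stationaryDenomFst γ h s) /
      (stationaryDenomFst γ h s * stationaryDenomSnd γ h s) := by positivity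
  linarith

/-- The distance of the initial covariance to the stationary one is polynomial in the condition
number `s₁ / t ^ 2`. -/
lemma abs_one_sub_stationaryCovariance_le (H : CriticalDamping t s₁ s γ h) (i j : Fin 2) :
    |(1 - stationaryCovariance γ h s) i j| ≤ 3 * (s₁ / t ^ 2) := by
  have ht := H.pos
  have ht1 := H.lt_one
  have hh := H.step_pos
  have hhs := H.step_mul_le
  have hh1 := H.step_le
  have hhγ := H.step_mul_friction_le
  have hs := H.s_pos
  have hγ := H.friction_pos
  have hγ3 := H.friction_le
  have hs1 := H.four_le
  have hhs0 : 0 < h * s := mul_pos hh hs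
  have hhγ0 : 0 < h * γ := mul_pos hh hγ
  have hT := H.two_mul_le_stationaryDenomFst
  have hT0 := H.stationaryDenomFst_pos
  have hU := H.three_le_stationaryDenomSnd
  have hU0 := H.stationaryDenomSnd_pos
  have ht2 : t ^ 2 ≤ t := by nlinarith
  have ht20 : 0 < t ^ 2 := by positivity
  have hK4 : 4 ≤ s₁ / t ^ 2 := by rw [le_div_iff₀ ht20]; nlinarith
  have hKt : 4 ≤ s₁ / t ^ 2 * t ^ 2 := by rw [div_mul_cancel₀ _ ht20.ne']; exact hs1
  have hKs : 1 / s ≤ s₁ / t ^ 2 := by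
    rw [div_le_div_iff₀ hs ht20]; nlinarith [H.sq_le]
  set K := s₁ / t ^ 2 with hK
  have hKt' : 4 ≤ K * t := by nlinarith
  have hKT : 8 ≤ K * stationaryDenomFst γ h s := by nlinarith
  have hTU : 24 ≤ K * (stationaryDenomFst γ h s * stationaryDenomSnd γ h s) := by
    nlinarith [mul_nonneg (sub_nonneg.2 hKT) hU0.le]
  have hTU0 : 0 < stationaryDenomFst γ h s * stationaryDenomSnd γ h s := mul_pos hT0 hU0
  -- it is enough to bound the numerators of the four entries
  have key : ∀ n c : ℝ, |n| ≤ 24 * c →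
      |n / (stationaryDenomFst γ h s * stationaryDenomSnd γ h s)| ≤ c * K := by
    intro n c hn
    rw [abs_div, abs_of_pos hTU0, div_le_iff₀ hTU0]
    have hc : 0 ≤ c := by linarith [abs_nonneg n]
    nlinarith
  have hB : |2 * h * (s - γ) / (stationaryDenomFst γ h s * stationaryDenomSnd γ h s)| ≤ 1 * K := by
    apply key
    rw [abs_le]; constructor <;> nlinarith
  have hY : |1 - (1 / s + h * (4 + (2 - h * (1 + γ)) * stationaryDenomFst γ h s) /
      (stationaryDenomFst γ h s * stationaryDenomSnd γ h s))| ≤ 3 * K := by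
    have h1 := key (h * 4) 1 (by rw [abs_le]; constructor <;> nlinarith)
    have h2 : h * (4 + (2 - h * (1 + γ)) * stationaryDenomFst γ h s) /
        (stationaryDenomFst γ h s * stationaryDenomSnd γ h s) =
        h * 4 / (stationaryDenomFst γ h s * stationaryDenomSnd γ h s) +
          h * (2 - h * (1 + γ)) / stationaryDenomSnd γ h s := by
      field_simp
    have h3 : h * (2 - h * (1 + γ)) / stationaryDenomSnd γ h s ≤ 1 := by
      rw [div_le_one hU0]; nlinarith
    have h4 : 0 ≤ h * (2 - h * (1 + γ)) / stationaryDenomSnd γ h s :=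
      div_nonneg (mul_nonneg hh.le (by linarith)) hU0.le
    have h5 : 0 < 1 / s := by positivity
    rw [h2]
    rw [abs_le] at h1 ⊢
    constructor <;> linarith
  have hW : |1 - (1 + h * (2 * γ ^ 2 + 4 * s + 2 * s * γ - 3 * h * s * γ * (1 + γ) -
      h * s ^ 2 * (1 + γ) + h ^ 2 * s ^ 2 * (1 + γ) ^ 2) /
        (stationaryDenomFst γ h s * stationaryDenomSnd γ h s))| ≤ 1 * K := by
    rw [sub_add_cancel_left, abs_neg]
    apply key
    have e : h * (2 * γ ^ 2 + 4 * s + 2 * s * γ - 3 * h * s * γ * (1 + γ) -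
        h * s ^ 2 * (1 + γ) + h ^ 2 * s ^ 2 * (1 + γ) ^ 2) =
        2 * (h * γ) * γ + 4 * (h * s) + 2 * (h * s) * γ - 3 * ((h * s) * (h * γ)) * (1 + γ) -
        (h * s) * (h * s) * (1 + γ) + (h * s) * (h * s) * (h * (1 + γ) * (1 + γ)) := by ring
    have b1 : (h * γ) * γ ≤ 3 / 20 * 3 := by gcongr
    have b2 : (h * s) * γ ≤ 1 / 5 * 3 := by gcongr
    have b3 : ((h * s) * (h * γ)) * (1 + γ) ≤ (1 / 5 * (3 / 20)) * (1 + 3) := by gcongr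
    have b4 : (h * s) * (h * s) * (1 + γ) ≤ 1 / 5 * (1 / 5) * (1 + 3) := by gcongr
    have b5 : (h * s) * (h * s) * (h * (1 + γ) * (1 + γ)) ≤
        1 / 5 * (1 / 5) * (1 / 20 * (1 + 3) * (1 + 3)) := by gcongr
    have c1 : 0 ≤ (h * γ) * γ := by positivity
    have c2 : 0 ≤ (h * s) * γ := by positivity
    have c3 : 0 ≤ ((h * s) * (h * γ)) * (1 + γ) := by positivity
    have c4 : 0 ≤ (h * s) * (h * s) * (1 + γ) := by positivity
    have c5 : 0 ≤ (h * s) * (h * s) * (h * (1 + γ) * (1 + γ)) := by positivity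
    rw [e, abs_le]
    constructor <;> linarith
  rw [Matrix.sub_apply]
  fin_cases i <;> fin_cases j <;>
    simp only [stationaryCovariance, Matrix.of_apply, Matrix.cons_val', Matrix.cons_val_zero,
      Matrix.cons_val_one, Matrix.one_apply, Fin.zero_eta, Fin.mk_one, Matrix.cons_val_fin_one,
      if_true, Fin.isValue, zero_ne_one, one_ne_zero, if_false, zero_sub, abs_neg]
  · exact hY
  · linarith
  · linarith
  · linarith

/-- The linear factor of a double root costs only a constant power of the rate. -/
lemma one_add_sq_mul_le {e : ℝ} (he : 0 < e) (he1 : e ≤ 1) (k : ℕ) :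
    (1 + (k : ℝ)) ^ 2 * (1 - e) ^ (2 * k) ≤ 12 / e ^ 2 * Real.exp (-(e * k)) := by
  have hk : (0 : ℝ) ≤ k := k.cast_nonneg
  have h1 : (1 - e) ^ (2 * k) ≤ Real.exp (-(2 * (e * k))) := by
    calc (1 - e) ^ (2 * k) ≤ Real.exp (-e) ^ (2 * k) :=
          pow_le_pow_left₀ (by linarith) (Real.one_sub_le_exp_neg e) _
      _ = Real.exp (-(2 * (e * k))) := by
          rw [← Real.exp_nat_mul]; congr 1; push_cast; ring
  have h2 : e * (1 + k) / 2 ≤ Real.exp (e * (1 + k) / 2) := by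
    linarith [Real.add_one_le_exp (e * (1 + k) / 2)]
  have h3 : (e * (1 + k) / 2) ^ 2 ≤ 3 * Real.exp (e * k) := by
    calc (e * (1 + k) / 2) ^ 2 ≤ Real.exp (e * (1 + k) / 2) ^ 2 :=
          pow_le_pow_left₀ (by positivity) h2 2
      _ = Real.exp e * Real.exp (e * k) := by
          rw [← Real.exp_nat_mul, ← Real.exp_add]; congr 1; push_cast; ring
      _ ≤ 3 * Real.exp (e * k) := by
          gcongr
          calc Real.exp e ≤ Real.exp 1 := Real.exp_le_exp.2 he1
            _ ≤ 3 := by linarith [Real.exp_one_lt_d9]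
  have h4 : (1 + (k : ℝ)) ^ 2 ≤ 12 / e ^ 2 * Real.exp (e * k) := by
    rw [div_mul_eq_mul_div, le_div_iff₀ (by positivity)]
    nlinarith
  calc (1 + (k : ℝ)) ^ 2 * (1 - e) ^ (2 * k)
      ≤ (12 / e ^ 2 * Real.exp (e * k)) * Real.exp (-(2 * (e * k))) := by
        gcongr
    _ = 12 / e ^ 2 * Real.exp (-(e * k)) := by
        rw [mul_assoc, ← Real.exp_add]; congr 2; ring

/-- Geometric convergence of the position variance, relative to its limit. -/
lemma abs_covarianceSeq_sub_le (H : CriticalDamping t s₁ s γ h) (k : ℕ) :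
    |covarianceSeq 1 γ h s k 0 0 - biasedVariance 1 γ h s| ≤
      10 ^ 7 * (s₁ / t ^ 2) ^ 4 * Real.exp (-(h * t / 4 * k)) * biasedVariance 1 γ h s := by
  have ht := H.pos
  have ht1 := H.lt_one
  have hh := H.step_pos
  have hh1 := H.step_le
  have hs := H.s_pos
  have hs1 := H.four_le
  have ht20 : 0 < t ^ 2 := by positivity
  have ht2 : t ^ 2 ≤ t := by nlinarith
  set K := s₁ / t ^ 2 with hK
  have hK0 : 0 < K := by positivity
  have he0 : 0 < h * t / 4 := by positivity
  have he1 : h * t / 4 ≤ 1 := by nlinarith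
  -- the inverse rate is polynomial in the condition number, like all the other prefactors
  have he : 1 ≤ 20 * K * (h * t / 4) := by
    rw [hK, H.step]
    have : 20 * (s₁ / t ^ 2) * (1 / (5 * s₁) * t / 4) = 1 / t := by
      field_simp; norm_num
    rw [this, le_div_iff₀ ht]; linarith
  set e := h * t / 4 with hedef
  set Y := biasedVariance 1 γ h s with hY
  have hYs : 1 ≤ K * Y := by
    have h1 : 1 / s ≤ Y := H.inv_le_biasedVariance
    have h2 : s ≤ K := by
      refine H.le.trans ?_
      rw [hK, le_div_iff₀ ht20]; nlinarith
    calc (1 : ℝ) = s * (1 / s) := by field_simp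
      _ ≤ K * Y := by gcongr
  have hdiff : covarianceSeq 1 γ h s k 0 0 - Y =
      (stepMatrix 1 γ h s ^ k * (1 - stationaryCovariance γ h s) *
        (stepMatrix 1 γ h s ^ k)ᵀ) 0 0 := by
    rw [hY, H.biasedVariance_eq_stationaryCovariance, ← Matrix.sub_apply, covarianceSeq_sub_eq
      (stationaryCovariance_fixed hs.ne' H.stationaryDenomFst_pos.ne'
        H.stationaryDenomSnd_pos.ne')]
  rw [hdiff]
  set A := stepMatrix 1 γ h s ^ k with hA
  set F := 1 - stationaryCovariance γ h s with hF
  set M := 4 * (1 + (k : ℝ)) * (1 - e) ^ k with hM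
  have hM0 : 0 ≤ M := by
    have : 0 ≤ 1 - e := by linarith
    positivity
  have hterm : ∀ i j, |A 0 i * F i j * A 0 j| ≤ M * (3 * K) * M := by
    intro i j
    rw [abs_mul, abs_mul]
    gcongr
    · exact H.abs_stepMatrix_pow_le k 0 i
    · exact H.abs_one_sub_stationaryCovariance_le i j
    · exact H.abs_stepMatrix_pow_le k 0 j
  have hsum : (A * F * Aᵀ) 0 0 = (A 0 0 * F 0 0 * A 0 0 + A 0 1 * F 1 0 * A 0 0) +
      (A 0 0 * F 0 1 * A 0 1 + A 0 1 * F 1 1 * A 0 1) := by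
    simp only [Matrix.mul_apply, Fin.sum_univ_two, Matrix.transpose_apply]
    ring
  calc |(A * F * Aᵀ) 0 0| ≤ 4 * (M * (3 * K) * M) := by
        rw [hsum]
        have h1 := hterm 0 0
        have h2 := hterm 1 0
        have h3 := hterm 0 1
        have h4 := hterm 1 1
        rw [abs_le] at h1 h2 h3 h4 ⊢
        constructor <;> linarith
    _ = 192 * K * ((1 + (k : ℝ)) ^ 2 * (1 - e) ^ (2 * k)) := by
        rw [hM, mul_comm 2 k, pow_mul]; ring
    _ ≤ 192 * K * (12 / e ^ 2 * Real.exp (-(e * k))) := by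
        exact mul_le_mul_of_nonneg_left (one_add_sq_mul_le he0 he1 k) (by positivity)
    _ ≤ 192 * K * (12 * (20 * K) ^ 2 * Real.exp (-(e * k))) := by
        gcongr
        rw [div_le_iff₀ (by positivity), mul_assoc, ← mul_pow]
        nlinarith
    _ = 921600 * K ^ 3 * Real.exp (-(e * k)) * 1 := by ring
    _ ≤ 10 ^ 7 * K ^ 3 * Real.exp (-(e * k)) * (K * Y) := by
        gcongr
        norm_num
    _ = 10 ^ 7 * K ^ 4 * Real.exp (-(e * k)) * Y := by ring

end CriticalDamping

/-! ### The law of the iterates -/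


/-- The characteristic function of a measure on `E × E`, as a function of two dual vectors. -/
noncomputable def jointCharFun {E : Type*} [NormedAddCommGroup E] [InnerProductSpace ℝ E]
    [MeasurableSpace E] (ν : Measure (E × E)) (u v : E) : ℂ :=
  ∫ w, Complex.exp ((⟪w.1, u⟫ + ⟪w.2, v⟫ : ℝ) * Complex.I) ∂ν

section

variable {E : Type*} [NormedAddCommGroup E] [InnerProductSpace ℝ E] [FiniteDimensional ℝ E]
  [MeasurableSpace E] [BorelSpace E]

omit [FiniteDimensional ℝ E] [BorelSpace E] in
lemma jointCharFun_prod (μ ν : Measure E) [SFinite μ] [SFinite ν] (u v : E) :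
    jointCharFun (μ.prod ν) u v = charFun μ u * charFun ν v := by
  simp only [jointCharFun, charFun_apply]
  rw [← integral_prod_mul]
  congr 1
  ext w
  rw [← Complex.exp_add]
  congr 1
  push_cast
  ring

lemma jointCharFun_stdGaussian (u v : E) :
    jointCharFun ((stdGaussian E).prod (stdGaussian E)) u v =
      Complex.exp (-((‖u‖ ^ 2 + ‖v‖ ^ 2 : ℝ) : ℂ) / 2) := by
  rw [jointCharFun_prod, charFun_stdGaussian, charFun_stdGaussian, ← Complex.exp_add]
  congr 1
  push_cast
  ring

lemma charFun_map_fst (ν : Measure (E × E)) (u : E) :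
    charFun (ν.map Prod.fst) u = jointCharFun ν u 0 := by
  rw [charFun_apply, integral_map (by fun_prop) (by fun_prop), jointCharFun]
  simp

end

section

variable {d : ℕ}

/-- `∇f x = S⁻¹ x`; symmetry of `S` is what makes the two halves of the derivative agree. -/
lemma gradient_quadPotential {S : Matrix (Fin d) (Fin d) ℝ} (hS : S.IsHermitian)
    (x : EuclideanSpace ℝ (Fin d)) :
    ∇ (quadPotential S) x = Matrix.toEuclideanCLM (𝕜 := ℝ) S⁻¹ x := by
  apply HasGradientAt.gradient
  rw [hasGradientAt_iff_hasFDerivAt]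
  have hT : IsSelfAdjoint (Matrix.toEuclideanCLM (n := Fin d) (𝕜 := ℝ) S⁻¹) :=
    (Matrix.IsHermitian.inv hS).isSelfAdjoint.map _
  set T := Matrix.toEuclideanCLM (n := Fin d) (𝕜 := ℝ) S⁻¹ with hTdef
  have hq : quadPotential S = fun x => (1 / 2 : ℝ) * ⟪T x, x⟫ := by
    ext x
    rw [quadPotential, EuclideanSpace.inner_eq_star_dotProduct]
    simp [hTdef, Matrix.ofLp_toEuclideanCLM]
  rw [hq]
  have h1 : HasFDerivAt (fun x => ⟪T x, x⟫) _ x :=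
    (T.hasFDerivAt (x := x)).inner ℝ (hasFDerivAt_id x)
  refine (h1.const_mul (1 / 2 : ℝ)).congr_fderiv ?_
  ext y
  have h2 : ⟪T y, x⟫ = ⟪y, T x⟫ := by
    rw [← ContinuousLinearMap.adjoint_inner_right, hT.adjoint_eq]
  simp [h2, real_inner_comm]
  ring

lemma measurable_gaulUpdate {S : Matrix (Fin d) (Fin d) ℝ} (hS : S.IsHermitian) (a γ h : ℝ) :
    Measurable (fun w : (EuclideanSpace ℝ (Fin d) × EuclideanSpace ℝ (Fin d)) ×
      (EuclideanSpace ℝ (Fin d) × EuclideanSpace ℝ (Fin d)) =>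
        gaulUpdate (quadPotential S) a γ h w.1 w.2) := by
  simp only [gaulUpdate, gradient_quadPotential hS]
  fun_prop

lemma isProbabilityMeasure_gaulOperator {S : Matrix (Fin d) (Fin d) ℝ} (hS : S.IsHermitian)
    (a γ h : ℝ) (ν : Measure (EuclideanSpace ℝ (Fin d) × EuclideanSpace ℝ (Fin d)))
    [IsProbabilityMeasure ν] : IsProbabilityMeasure (gaulOperator (quadPotential S) a γ h ν) :=
  Measure.isProbabilityMeasure_map (measurable_gaulUpdate hS a γ h).aemeasurable

lemma isProbabilityMeasure_gaulOperator_iterate {S : Matrix (Fin d) (Fin d) ℝ}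
    (hS : S.IsHermitian) (a γ h : ℝ)
    (ν : Measure (EuclideanSpace ℝ (Fin d) × EuclideanSpace ℝ (Fin d)))
    [IsProbabilityMeasure ν] (k : ℕ) :
    IsProbabilityMeasure ((gaulOperator (quadPotential S) a γ h)^[k] ν) := by
  induction k with
  | zero => simpa
  | succ k ih =>
    rw [Function.iterate_succ_apply']
    exact isProbabilityMeasure_gaulOperator hS a γ h _

/-- One step acts on characteristic functions by the transposed linear part, times the
characteristic function of the noise. -/
lemma jointCharFun_gaulOperator {S : Matrix (Fin d) (Fin d) ℝ} (hS : S.IsHermitian) {a γ h : ℝ}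
    (ha : 0 ≤ 2 * a * h) (hγ : 0 ≤ 2 * γ * h)
    (ν : Measure (EuclideanSpace ℝ (Fin d) × EuclideanSpace ℝ (Fin d))) [IsProbabilityMeasure ν]
    (u v : EuclideanSpace ℝ (Fin d)) :
    jointCharFun (gaulOperator (quadPotential S) a γ h ν) u v =
      jointCharFun ν
        (u - (a * h) • Matrix.toEuclideanCLM (𝕜 := ℝ) S⁻¹ u -
          h • Matrix.toEuclideanCLM (𝕜 := ℝ) S⁻¹ v)
        (h • u + (1 - γ * h) • v) *
      Complex.exp (-((2 * a * h * ‖u‖ ^ 2 + 2 * γ * h * ‖v‖ ^ 2 : ℝ) : ℂ) / 2) := by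
  have hT : IsSelfAdjoint (Matrix.toEuclideanCLM (n := Fin d) (𝕜 := ℝ) S⁻¹) :=
    (Matrix.IsHermitian.inv hS).isSelfAdjoint.map _
  have hnoise := jointCharFun_stdGaussian (√(2 * a * h) • u) (√(2 * γ * h) • v)
  rw [norm_smul, norm_smul, mul_pow, mul_pow, Real.norm_eq_abs, Real.norm_eq_abs, sq_abs, sq_abs,
    Real.sq_sqrt ha, Real.sq_sqrt hγ] at hnoise
  rw [← hnoise, jointCharFun, gaulOperator, integral_map
    (measurable_gaulUpdate hS a γ h).aemeasurable (by fun_prop), jointCharFun, jointCharFun,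
    ← integral_prod_mul]
  congr 1
  ext w
  rw [← Complex.exp_add, ← add_mul, ← Complex.ofReal_add]
  congr 3
  set T := Matrix.toEuclideanCLM (n := Fin d) (𝕜 := ℝ) S⁻¹ with hTdef
  have hsym : ∀ x y, ⟪T x, y⟫ = ⟪x, T y⟫ := fun x y => by
    rw [← ContinuousLinearMap.adjoint_inner_right, hT.adjoint_eq]
  simp only [gaulUpdate, gradient_quadPotential hS, ← hTdef, inner_add_left, inner_sub_left,
    inner_smul_left, inner_add_right, inner_sub_right, inner_smul_right, hsym, conj_trivial]
  ring

/-- The coordinates of the dual vector `(u, v)` in the plane of the `i`-th column of `P`. -/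
noncomputable def eigenCoord (P : Matrix (Fin d) (Fin d) ℝ) (u v : EuclideanSpace ℝ (Fin d))
    (i : Fin d) : Fin 2 → ℝ :=
  ![(Pᵀ *ᵥ u.ofLp) i, (Pᵀ *ᵥ v.ofLp) i]

lemma sum_sq_transpose_mulVec {P : Matrix (Fin d) (Fin d) ℝ}
    (hP : P ∈ Matrix.orthogonalGroup (Fin d) ℝ) (u : EuclideanSpace ℝ (Fin d)) :
    ∑ i, ((Pᵀ *ᵥ u.ofLp) i) ^ 2 = ‖u‖ ^ 2 := by
  have h1 : P * Pᵀ = 1 := (Matrix.mem_orthogonalGroup_iff _ _).1 hP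
  have h2 : ∑ i, ((Pᵀ *ᵥ u.ofLp) i) ^ 2 = (Pᵀ *ᵥ u.ofLp) ⬝ᵥ (Pᵀ *ᵥ u.ofLp) := by
    simp [dotProduct, sq]
  rw [h2, Matrix.dotProduct_mulVec, Matrix.vecMul_transpose, Matrix.mulVec_mulVec, h1,
    Matrix.one_mulVec, EuclideanSpace.real_norm_sq_eq]
  simp [dotProduct, sq]

lemma transpose_mulVec_inv {S P : Matrix (Fin d) (Fin d) ℝ} {s : Fin d → ℝ}
    (hP : P ∈ Matrix.orthogonalGroup (Fin d) ℝ) (hSP : S⁻¹ = P * Matrix.diagonal s * Pᵀ)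
    (u : EuclideanSpace ℝ (Fin d)) (i : Fin d) :
    (Pᵀ *ᵥ (Matrix.toEuclideanCLM (𝕜 := ℝ) S⁻¹ u).ofLp) i = s i * (Pᵀ *ᵥ u.ofLp) i := by
  have h1 : Pᵀ * P = 1 := (Matrix.mem_orthogonalGroup_iff' _ _).1 hP
  rw [Matrix.ofLp_toEuclideanCLM, hSP, Matrix.mulVec_mulVec, ← mul_assoc, ← mul_assoc, h1, one_mul,
    ← Matrix.mulVec_mulVec, Matrix.mulVec_diagonal]

/-- In the eigenbasis of the precision matrix the planes decouple: the law of the `k`-th iterate is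
centred Gaussian, with covariance `covarianceSeq` in the plane of each eigenvector. -/
lemma jointCharFun_gaulOperator_iterate {S P : Matrix (Fin d) (Fin d) ℝ} {s : Fin d → ℝ}
    (hS : S.IsHermitian) (hP : P ∈ Matrix.orthogonalGroup (Fin d) ℝ)
    (hSP : S⁻¹ = P * Matrix.diagonal s * Pᵀ) {a γ h : ℝ}
    (ha : 0 ≤ 2 * a * h) (hγ : 0 ≤ 2 * γ * h) (k : ℕ) (u v : EuclideanSpace ℝ (Fin d)) :
    jointCharFun ((gaulOperator (quadPotential S) a γ h)^[k]
      ((stdGaussian (EuclideanSpace ℝ (Fin d))).prod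
        (stdGaussian (EuclideanSpace ℝ (Fin d))))) u v =
      Complex.exp (-((∑ i, eigenCoord P u v i ⬝ᵥ
        (covarianceSeq a γ h (s i) k *ᵥ eigenCoord P u v i) : ℝ) : ℂ) / 2) := by
  induction k generalizing u v with
  | zero =>
    rw [Function.iterate_zero_apply, jointCharFun_stdGaussian]
    congr 4
    rw [← sum_sq_transpose_mulVec hP u, ← sum_sq_transpose_mulVec hP v, ← Finset.sum_add_distrib]
    refine Finset.sum_congr rfl fun i _ => ?_
    simp [covarianceSeq, eigenCoord, sq]
  | succ k ih =>
    have := isProbabilityMeasure_gaulOperator_iterate hS a γ h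
      ((stdGaussian (EuclideanSpace ℝ (Fin d))).prod
        (stdGaussian (EuclideanSpace ℝ (Fin d)))) k
    rw [Function.iterate_succ_apply', jointCharFun_gaulOperator hS ha hγ, ih, ← Complex.exp_add]
    congr 1
    rw [← add_div, ← neg_add, ← Complex.ofReal_add]
    congr 3
    rw [← sum_sq_transpose_mulVec hP u, ← sum_sq_transpose_mulVec hP v, Finset.mul_sum,
      Finset.mul_sum, ← Finset.sum_add_distrib, ← Finset.sum_add_distrib]
    refine Finset.sum_congr rfl fun i _ => ?_
    have hcoord : eigenCoord P
        (u - (a * h) • Matrix.toEuclideanCLM (𝕜 := ℝ) S⁻¹ u -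
          h • Matrix.toEuclideanCLM (𝕜 := ℝ) S⁻¹ v) (h • u + (1 - γ * h) • v) i =
        (stepMatrix a γ h (s i))ᵀ *ᵥ eigenCoord P u v i := by
      ext j
      fin_cases j
      · simp [eigenCoord, stepMatrix, Matrix.mulVec_sub, Matrix.mulVec_smul,
          transpose_mulVec_inv hP hSP, -Matrix.ofLp_toEuclideanCLM]
        ring
      · simp [eigenCoord, stepMatrix, Matrix.mulVec_add, Matrix.mulVec_smul]
    have hD : eigenCoord P u v i ⬝ᵥ (!![2 * a * h, 0; 0, 2 * γ * h] *ᵥ eigenCoord P u v i) =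
        2 * a * h * ((Pᵀ *ᵥ u.ofLp) i) ^ 2 + 2 * γ * h * ((Pᵀ *ᵥ v.ofLp) i) ^ 2 := by
      simp [eigenCoord, dotProduct, Matrix.mulVec, Fin.sum_univ_two]
      ring
    rw [hcoord, covarianceSeq, Matrix.add_mulVec, dotProduct_add, hD, ← Matrix.mulVec_mulVec,
      ← Matrix.mulVec_mulVec, Matrix.dotProduct_mulVec _ (stepMatrix a γ h (s i)),
      Matrix.mulVec_transpose]

lemma posDef_conj_diagonal {P : Matrix (Fin d) (Fin d) ℝ}
    (hP : P ∈ Matrix.orthogonalGroup (Fin d) ℝ) {V : Fin d → ℝ} (hV : ∀ i, 0 < V i) :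
    (P * Matrix.diagonal V * Pᵀ).PosDef := by
  have hu : IsUnit P := by
    apply IsUnit.of_mul_eq_one Pᵀ
    exact (Matrix.mem_orthogonalGroup_iff _ _).1 hP
  have := (Matrix.IsUnit.posDef_star_right_conjugate_iff (x := Matrix.diagonal V) hu).2
    (Matrix.PosDef.diagonal hV)
  simpa [Matrix.star_eq_conjTranspose, Matrix.conjTranspose_eq_transpose_of_trivial] using this

lemma dotProduct_conj_diagonal (P : Matrix (Fin d) (Fin d) ℝ) (V : Fin d → ℝ) (u : Fin d → ℝ) :
    u ⬝ᵥ ((P * Matrix.diagonal V * Pᵀ) *ᵥ u) = ∑ i, V i * ((Pᵀ *ᵥ u) i) ^ 2 := by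
  rw [← Matrix.mulVec_mulVec, ← Matrix.mulVec_mulVec, Matrix.dotProduct_mulVec,
    ← Matrix.mulVec_transpose]
  simp only [dotProduct, Matrix.mulVec_diagonal]
  exact Finset.sum_congr rfl fun i _ => by ring

/-- The position marginal is the Gaussian whose covariance has the position entries of
`covarianceSeq` as eigenvalues. -/
lemma gaulPositionLaw_eq {S P : Matrix (Fin d) (Fin d) ℝ} {s : Fin d → ℝ}
    (hS : S.IsHermitian) (hP : P ∈ Matrix.orthogonalGroup (Fin d) ℝ)
    (hSP : S⁻¹ = P * Matrix.diagonal s * Pᵀ) {a γ h : ℝ}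
    (ha : 0 ≤ 2 * a * h) (hγ : 0 ≤ 2 * γ * h) (k : ℕ)
    (hV : ∀ i, 0 < covarianceSeq a γ h (s i) k 0 0) :
    gaulPositionLaw (quadPotential S) a γ h k = multivariateGaussian 0
      (P * Matrix.diagonal (fun i => covarianceSeq a γ h (s i) k 0 0) * Pᵀ) := by
  have := isProbabilityMeasure_gaulOperator_iterate hS a γ h
    ((stdGaussian (EuclideanSpace ℝ (Fin d))).prod
      (stdGaussian (EuclideanSpace ℝ (Fin d)))) k
  have : IsProbabilityMeasure (gaulPositionLaw (quadPotential S) a γ h k) :=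
    Measure.isProbabilityMeasure_map (by fun_prop)
  apply Measure.ext_of_charFun
  ext u
  rw [charFun_multivariateGaussian (posDef_conj_diagonal hP hV).posSemidef,
    dotProduct_conj_diagonal, gaulPositionLaw, charFun_map_fst,
    jointCharFun_gaulOperator_iterate hS hP hSP ha hγ]
  congr 1
  have : ∀ i, eigenCoord P u 0 i ⬝ᵥ (covarianceSeq a γ h (s i) k *ᵥ eigenCoord P u 0 i) =
      covarianceSeq a γ h (s i) k 0 0 * ((Pᵀ *ᵥ u.ofLp) i) ^ 2 := by
    intro i
    simp [eigenCoord, dotProduct, Matrix.mulVec, Fin.sum_univ_two]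
    ring
  simp only [this, inner_zero_right]
  push_cast
  ring

end

/-! ### Total variation distance of Gaussians with the same eigenbasis -/


/-- A density ratio bound on each factor gives one on the product. -/
lemma pi_le_smul_pi {ι : Type*} [Fintype ι] {α : ι → Type*} [∀ i, MeasurableSpace (α i)]
    {μ ν : ∀ i, Measure (α i)} [∀ i, SigmaFinite (μ i)] [∀ i, SigmaFinite (ν i)] {c : ℝ≥0}
    (h : ∀ i, μ i ≤ c • ν i) :
    Measure.pi μ ≤ c ^ Fintype.card ι • Measure.pi ν := by
  have h1 : Measure.pi (fun i => c • ν i) = c ^ Fintype.card ι • Measure.pi ν := by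
    refine Measure.pi_eq fun s _ => ?_
    rw [Measure.coe_nnreal_smul_apply]
    simp [Finset.prod_mul_distrib]
  rw [← h1]
  have h2 : (Measure.pi μ).toOuterMeasure ≤
      OuterMeasure.pi fun i => (c • ν i).toOuterMeasure := by
    refine OuterMeasure.le_pi.2 fun s _ => ?_
    change Measure.pi μ (Set.univ.pi s) ≤ ∏ i, (c • ν i) (s i)
    rw [Measure.pi_pi]
    exact Finset.prod_le_prod' fun i _ => h i (s i)
  rw [Measure.le_iff]
  intro s hs
  rw [Measure.pi_def (fun i => c • ν i), toMeasure_apply _ _ hs]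
  exact h2 s

/-- Enlarging the variance of a centred Gaussian lowers the density at most by the ratio of the
standard deviations; the square root is not needed here. -/
lemma gaussianReal_le_smul {m V c : ℝ≥0} (hm : 0 < m) (hmV : m ≤ V) (hVc : V ≤ c * m) :
    gaussianReal 0 m ≤ c • gaussianReal 0 V := by
  have hV : 0 < V := hm.trans_le hmV
  have hc : 1 ≤ c := by
    by_contra! hcon
    exact absurd (hmV.trans hVc) (not_le.2 (mul_lt_of_lt_one_left hm hcon))
  rw [gaussianReal_of_var_ne_zero _ hm.ne', gaussianReal_of_var_ne_zero _ hV.ne',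
    ENNReal.smul_def, ← withDensity_smul _ (measurable_gaussianPDF 0 V)]
  refine withDensity_mono (ae_of_all _ fun x => ?_)
  have hmR : (0 : ℝ) < m := hm
  have hVR : (0 : ℝ) < V := hV
  have hcR : (1 : ℝ) ≤ c := hc
  have h1 : gaussianPDFReal 0 m x ≤ c * gaussianPDFReal 0 V x := by
    have e1 : (√(2 * Real.pi * m))⁻¹ ≤ c * (√(2 * Real.pi * V))⁻¹ := by
      rw [← div_eq_mul_inv, inv_eq_one_div, div_le_div_iff₀ (by positivity) (by positivity),
        one_mul]
      refine Real.sqrt_le_iff.2 ⟨by positivity, ?_⟩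
      rw [mul_pow, Real.sq_sqrt (by positivity)]
      have : (V : ℝ) ≤ c * m := by exact_mod_cast hVc
      calc 2 * Real.pi * (V : ℝ) ≤ 2 * Real.pi * (c * m) := by gcongr
        _ ≤ 2 * Real.pi * (c ^ 2 * m) := by gcongr; nlinarith
        _ = _ := by ring
    have e2 : Real.exp (-(x - 0) ^ 2 / (2 * m)) ≤ Real.exp (-(x - 0) ^ 2 / (2 * V)) := by
      rw [Real.exp_le_exp, neg_div, neg_div, neg_le_neg_iff]
      gcongr
    calc gaussianPDFReal 0 m x
        = (√(2 * Real.pi * m))⁻¹ * Real.exp (-(x - 0) ^ 2 / (2 * m)) := rfl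
      _ ≤ c * (√(2 * Real.pi * V))⁻¹ * Real.exp (-(x - 0) ^ 2 / (2 * V)) := by gcongr
      _ = c * gaussianPDFReal 0 V x := by rw [gaussianPDFReal, mul_assoc]
  calc gaussianPDF 0 m x = ENNReal.ofReal (gaussianPDFReal 0 m x) := rfl
    _ ≤ ENNReal.ofReal (c * gaussianPDFReal 0 V x) := ENNReal.ofReal_le_ofReal h1
    _ = _ := by
      rw [ENNReal.ofReal_mul (by positivity), ENNReal.ofReal_coe_nnreal]
      rfl

/-- A density ratio bound controls the total variation distance: apply it to a set and to its
complement. -/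
lemma abs_real_sub_le_of_le_smul {Ω : Type*} [MeasurableSpace Ω] {μ ν : Measure Ω}
    [IsProbabilityMeasure μ] [IsProbabilityMeasure ν] {c : ℝ≥0} (h : μ ≤ c • ν)
    {A : Set Ω} (hA : MeasurableSet A) : |μ.real A - ν.real A| ≤ c - 1 := by
  have h1 : ∀ B : Set Ω, μ.real B ≤ c * ν.real B := by
    intro B
    have := ENNReal.toReal_mono (measure_ne_top (c • ν) B) (h B)
    simpa [Measure.coe_nnreal_smul_apply, Measure.real] using this
  have hc : (1 : ℝ) ≤ c := by simpa using h1 Set.univ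
  have h2 : ∀ B : Set Ω, μ.real B - ν.real B ≤ c - 1 := by
    intro B
    nlinarith [h1 B, measureReal_le_one (μ := ν) (s := B)]
  have h3 := h2 Aᶜ
  rw [probReal_compl_eq_one_sub hA, probReal_compl_eq_one_sub hA] at h3
  rw [abs_le]
  constructor <;> linarith [h2 A]

section

variable {d : ℕ}

lemma multivariateGaussian_conj_diagonal {P : Matrix (Fin d) (Fin d) ℝ}
    (hP : P ∈ Matrix.orthogonalGroup (Fin d) ℝ) {V : Fin d → ℝ≥0} (hV : ∀ i, 0 < V i) :
    multivariateGaussian 0 (P * Matrix.diagonal (fun i => (V i : ℝ)) * Pᵀ) =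
      ((Measure.pi fun i => gaussianReal 0 (V i)).map (WithLp.toLp 2)).map
        (Matrix.toEuclideanCLM (𝕜 := ℝ) P) := by
  have h0 : IsProbabilityMeasure ((Measure.pi fun i => gaussianReal 0 (V i)).map
      (WithLp.toLp 2)) := Measure.isProbabilityMeasure_map (by fun_prop)
  have : IsProbabilityMeasure (((Measure.pi fun i => gaussianReal 0 (V i)).map
      (WithLp.toLp 2)).map (Matrix.toEuclideanCLM (𝕜 := ℝ) P)) :=
    Measure.isProbabilityMeasure_map (by fun_prop)
  apply Measure.ext_of_charFun
  ext u
  have hadj : ∀ x, ⟪Matrix.toEuclideanCLM (𝕜 := ℝ) P x, u⟫ =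
      ⟪x, Matrix.toEuclideanCLM (𝕜 := ℝ) Pᵀ u⟫ := by
    intro x
    have : Matrix.toEuclideanCLM (n := Fin d) (𝕜 := ℝ) Pᵀ =
        ContinuousLinearMap.adjoint (Matrix.toEuclideanCLM (𝕜 := ℝ) P) := by
      rw [← ContinuousLinearMap.star_eq_adjoint, ← map_star, Matrix.star_eq_conjTranspose,
        Matrix.conjTranspose_eq_transpose_of_trivial]
    rw [this, ContinuousLinearMap.adjoint_inner_right]
  have hmap : charFun (((Measure.pi fun i => gaussianReal 0 (V i)).map
      (WithLp.toLp 2)).map (Matrix.toEuclideanCLM (𝕜 := ℝ) P)) u =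
      charFun ((Measure.pi fun i => gaussianReal 0 (V i)).map (WithLp.toLp 2))
        (Matrix.toEuclideanCLM (𝕜 := ℝ) Pᵀ u) := by
    rw [charFun_apply, integral_map (by fun_prop) (by fun_prop), charFun_apply]
    simp only [hadj]
  rw [hmap, charFun_pi, charFun_multivariateGaussian
    (posDef_conj_diagonal hP fun i => NNReal.coe_pos.2 (hV i)).posSemidef,
    dotProduct_conj_diagonal]
  simp only [charFun_gaussianReal, ← Complex.exp_sum, inner_zero_right]
  congr 1
  push_cast
  simp [Finset.sum_div, Finset.sum_neg_distrib]

lemma multivariateGaussian_le_smul {P : Matrix (Fin d) (Fin d) ℝ}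
    (hP : P ∈ Matrix.orthogonalGroup (Fin d) ℝ) {m V : Fin d → ℝ≥0} {c : ℝ≥0}
    (hm : ∀ i, 0 < m i) (hmV : ∀ i, m i ≤ V i) (hVc : ∀ i, V i ≤ c * m i) :
    multivariateGaussian 0 (P * Matrix.diagonal (fun i => (m i : ℝ)) * Pᵀ) ≤
      c ^ d • multivariateGaussian 0 (P * Matrix.diagonal (fun i => (V i : ℝ)) * Pᵀ) := by
  rw [multivariateGaussian_conj_diagonal hP hm,
    multivariateGaussian_conj_diagonal hP fun i => (hm i).trans_le (hmV i),
    ← Measure.map_smul, ← Measure.map_smul]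
  refine Measure.map_mono (Measure.map_mono ?_ (by fun_prop)) (by fun_prop)
  simpa using pi_le_smul_pi fun i => gaussianReal_le_smul (hm i) (hmV i) (hVc i)

/-- If the eigenvalues of two covariance matrices with a common eigenbasis have relative distance
`η`, the total variation distance of the Gaussians is at most `8 d η`. The comparison goes through
the Gaussian with the smaller of the two variances in each direction, which has a bounded density
with respect to both. -/
lemma tvDist_multivariateGaussian_le {P : Matrix (Fin d) (Fin d) ℝ}
    (hP : P ∈ Matrix.orthogonalGroup (Fin d) ℝ) (hd : 0 < d) {V Y : Fin d → ℝ} {η : ℝ}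
    (hY : ∀ i, 0 < Y i) (hη : 0 ≤ η) (hdη : 2 * d * η ≤ 1)
    (h : ∀ i, |V i - Y i| ≤ η * Y i) :
    tvDist (multivariateGaussian 0 (P * Matrix.diagonal V * Pᵀ))
      (multivariateGaussian 0 (P * Matrix.diagonal Y * Pᵀ)) ≤ 8 * d * η := by
  have hd1 : (1 : ℝ) ≤ d := by exact_mod_cast hd
  have hη2 : η ≤ 1 / 2 := by nlinarith
  have hV : ∀ i, 0 < V i := fun i => by
    have := (abs_le.1 (h i)).1
    nlinarith [hY i]
  lift V to Fin d → ℝ≥0 using fun i => (hV i).le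
  lift Y to Fin d → ℝ≥0 using fun i => (hY i).le
  have hc0 : 0 ≤ 1 + 2 * η := by linarith
  obtain ⟨c, hc⟩ : ∃ c : ℝ≥0, (c : ℝ) = 1 + 2 * η := ⟨⟨_, hc0⟩, rfl⟩
  set m : Fin d → ℝ≥0 := fun i => min (V i) (Y i) with hm
  have hmi : ∀ i, (m i : ℝ) = min (V i : ℝ) (Y i : ℝ) := fun i => NNReal.coe_min _ _
  have hm0 : ∀ i, 0 < m i := fun i =>
    lt_min (NNReal.coe_pos.1 (hV i)) (NNReal.coe_pos.1 (hY i))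
  have hVc : ∀ i, V i ≤ c * m i := by
    intro i
    have h1 := abs_le.1 (h i)
    have h2 := hY i
    rw [← NNReal.coe_le_coe, NNReal.coe_mul, hmi, hc]
    rcases le_total (V i : ℝ) (Y i) with h3 | h3
    · rw [min_eq_left h3]; nlinarith
    · rw [min_eq_right h3]; nlinarith
  have hYc : ∀ i, Y i ≤ c * m i := by
    intro i
    have h1 := abs_le.1 (h i)
    have h2 := hY i
    rw [← NNReal.coe_le_coe, NNReal.coe_mul, hmi, hc]
    rcases le_total (V i : ℝ) (Y i) with h3 | h3
    · have h4 : (1 - η) * (Y i : ℝ) ≤ V i := by linarith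
      have h5 : (1 : ℝ) ≤ (1 + 2 * η) * (1 - η) := by nlinarith
      rw [min_eq_left h3]
      calc (Y i : ℝ) ≤ (1 + 2 * η) * (1 - η) * Y i := by nlinarith
        _ = (1 + 2 * η) * ((1 - η) * Y i) := by ring
        _ ≤ (1 + 2 * η) * V i := by gcongr
    · rw [min_eq_right h3]; nlinarith
  have hLV := multivariateGaussian_le_smul hP hm0 (fun i => min_le_left _ _) hVc
  have hLY := multivariateGaussian_le_smul hP hm0 (fun i => min_le_right _ _) hYc
  have hpow : ((c ^ d : ℝ≥0) : ℝ) - 1 ≤ 4 * d * η := by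
    have h1 : ((c ^ d : ℝ≥0) : ℝ) ≤ Real.exp (2 * d * η) := by
      rw [NNReal.coe_pow, hc]
      calc (1 + 2 * η) ^ d ≤ Real.exp (2 * η) ^ d :=
            pow_le_pow_left₀ hc0 (by linarith [Real.add_one_le_exp (2 * η)]) d
        _ = Real.exp (2 * d * η) := by rw [← Real.exp_nat_mul]; congr 1; ring
    have h2 : 0 ≤ 2 * d * η := by positivity
    have h3 := Real.abs_exp_sub_one_le (x := 2 * d * η) (by rwa [abs_of_nonneg h2])
    rw [abs_of_nonneg h2] at h3
    linarith [le_abs_self (Real.exp (2 * d * η) - 1)]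
  have : Nonempty {A : Set (EuclideanSpace ℝ (Fin d)) // MeasurableSet A} :=
    ⟨⟨∅, MeasurableSet.empty⟩⟩
  refine ciSup_le fun A => ?_
  have h1 := abs_le.1 (abs_real_sub_le_of_le_smul hLV A.2)
  have h2 := abs_le.1 (abs_real_sub_le_of_le_smul hLY A.2)
  rw [abs_le]
  constructor <;> linarith [h1.1, h1.2, h2.1, h2.2]

end

/-! ### Mixing time -/

lemma eigenvalues_pos {d : ℕ} {S P : Matrix (Fin d) (Fin d) ℝ} {s : Fin d → ℝ} (hS : S.PosDef)
    (hP : P ∈ Matrix.orthogonalGroup (Fin d) ℝ) (hSP : S⁻¹ = P * Matrix.diagonal s * Pᵀ)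
    (i : Fin d) : 0 < s i := by
  have hu : IsUnit P := IsUnit.of_mul_eq_one Pᵀ ((Matrix.mem_orthogonalGroup_iff _ _).1 hP)
  have h1 : (P * Matrix.diagonal s * star P).PosDef := by
    have := hS.inv
    rw [hSP] at this
    simpa [Matrix.star_eq_conjTranspose, Matrix.conjTranspose_eq_transpose_of_trivial] using this
  exact Matrix.posDef_diagonal_iff.1
    ((Matrix.IsUnit.posDef_star_right_conjugate_iff hu).1 h1) i

lemma tvDist_nonneg {Ω : Type*} [MeasurableSpace Ω] (μ ν : Measure Ω) : 0 ≤ tvDist μ ν :=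
  Real.iSup_nonneg fun _ => abs_nonneg _

/-- At critical damping the position law approaches the biased target geometrically, with a
prefactor polynomial in the dimension and the condition number `s₁ / t ^ 2`. -/
lemma tvDist_gaulPositionLaw_le {d : ℕ} (hd : 0 < d) {S P : Matrix (Fin d) (Fin d) ℝ}
    {s : Fin d → ℝ} {t s₁ γ h : ℝ} (hS : S.IsHermitian)
    (hP : P ∈ Matrix.orthogonalGroup (Fin d) ℝ) (hSP : S⁻¹ = P * Matrix.diagonal s * Pᵀ)
    (H : ∀ i, CriticalDamping t s₁ (s i) γ h) (k : ℕ)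
    (hk : 8 * d * (10 ^ 7 * (s₁ / t ^ 2) ^ 4 * Real.exp (-(h * t / 4 * k))) ≤ 1) :
    tvDist (gaulPositionLaw (quadPotential S) 1 γ h k)
      (multivariateGaussian 0 (biasedCovariance P s 1 γ h)) ≤
      8 * d * (10 ^ 7 * (s₁ / t ^ 2) ^ 4 * Real.exp (-(h * t / 4 * k))) := by
  set η := 10 ^ 7 * (s₁ / t ^ 2) ^ 4 * Real.exp (-(h * t / 4 * k)) with hη
  have hη0 : 0 ≤ η := by
    rw [hη, show (s₁ / t ^ 2) ^ 4 = ((s₁ / t ^ 2) ^ 2) ^ 2 by ring]; positivity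
  have hd1 : (1 : ℝ) ≤ d := by exact_mod_cast hd
  have hdη : 0 ≤ d * η := by positivity
  have hh := (H ⟨0, hd⟩).step_pos
  have hγ := (H ⟨0, hd⟩).friction_pos
  have hY : ∀ i, 0 < biasedVariance 1 γ h (s i) := fun i =>
    (one_div_pos.2 (H i).s_pos).trans_le (H i).inv_le_biasedVariance
  have hV := fun i => (H i).abs_covarianceSeq_sub_le k
  have hη1 : η < 1 := by nlinarith
  have hpos : ∀ i, 0 < covarianceSeq 1 γ h (s i) k 0 0 := fun i => by
    have h1 := (abs_le.1 (hV i)).1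
    rw [← hη] at h1
    nlinarith [hY i]
  rw [gaulPositionLaw_eq hS hP hSP (by positivity) (by positivity) k hpos, biasedCovariance]
  exact tvDist_multivariateGaussian_le hP hd hY hη0 (by linarith) hV

/-- Solving `A * exp (-e k) ≤ δ` for `k`. -/
lemma mul_exp_neg_le_of_log_div_le {A e δ : ℝ} {k : ℕ} (hA : 0 < A) (he : 0 < e) (hδ : 0 < δ)
    (hk : Real.log (A / δ) / e ≤ k) : A * Real.exp (-(e * k)) ≤ δ := by
  rw [div_le_iff₀ he] at hk
  calc A * Real.exp (-(e * k)) ≤ A * Real.exp (-Real.log (A / δ)) := by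
        gcongr; linarith
    _ = δ := by
        rw [Real.exp_neg, Real.exp_log (by positivity)]; field_simp

/-- The prefactor enters the mixing time through its logarithm only. -/
lemma log_prefactor_le {d κ δ : ℝ} (hd : 1 ≤ d) (hκ : 4 ≤ κ) (hδ : 0 < δ) (hδ1 : δ < 1) :
    1 ≤ Real.log κ + Real.log (1 / δ) + Real.log d ∧
    Real.log (8 * d * (10 ^ 7 * κ ^ 4) / δ) ≤
      24 * (Real.log κ + Real.log (1 / δ) + Real.log d) := by
  have h1 : 1 ≤ Real.log κ := by
    rw [Real.le_log_iff_exp_le (by linarith)]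
    linarith [Real.exp_one_lt_d9]
  have h2 : 0 ≤ Real.log (1 / δ) := Real.log_nonneg (by rw [le_div_iff₀ hδ]; linarith)
  have h3 : 0 ≤ Real.log d := Real.log_nonneg hd
  have h4 : Real.log (8 * 10 ^ 7) ≤ 20 := by
    rw [Real.log_le_iff_le_exp (by norm_num)]
    calc (8 * 10 ^ 7 : ℝ) ≤ 2.7 ^ 20 := by norm_num
      _ ≤ Real.exp 1 ^ 20 := by
        gcongr
        linarith [Real.exp_one_gt_d9]
      _ = Real.exp 20 := by rw [← Real.exp_nat_mul]; norm_num
  have h5 : Real.log (8 * d * (10 ^ 7 * κ ^ 4) / δ) =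
      Real.log (8 * 10 ^ 7) + Real.log d + 4 * Real.log κ + Real.log (1 / δ) := by
    rw [show 8 * d * (10 ^ 7 * κ ^ 4) / δ = 8 * 10 ^ 7 * d * κ ^ 4 * (1 / δ) by ring,
      Real.log_mul (by positivity) (by positivity), Real.log_mul (by positivity) (by positivity),
      Real.log_mul (by positivity) (by positivity), Real.log_pow]
    norm_num
  refine ⟨by linarith, ?_⟩
  rw [h5]
  generalize Real.log (8 * 10 ^ 7) = l at h4
  linarith

theorem mainTheorem3 :
    ∃ C : ℝ, 0 < C ∧
      ∀ (d : ℕ) (hd : 0 < d) (S P : Matrix (Fin d) (Fin d) ℝ) (s : Fin d → ℝ)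
        (s₁ sd κ a γ h : ℝ),
        S.PosDef →
        P ∈ Matrix.orthogonalGroup (Fin d) ℝ →
        S⁻¹ = P * Matrix.diagonal s * Pᵀ →
        Antitone s →
        s₁ = s ⟨0, hd⟩ →
        sd = s ⟨d - 1, Nat.sub_lt hd Nat.one_pos⟩ →
        1 < s₁ → sd < 1 →
        2 ≤ √s₁ - √sd →
        κ = s₁ / sd →
        a = 1 →
        γ = sd + 2 * √sd →
        h = 1 / (5 * s₁) →
        (biasedCovariance P s a γ h).PosDef ∧
        Tendsto (fun k : ℕ => tvDist (gaulPositionLaw (quadPotential S) a γ h k)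
            (multivariateGaussian 0 (biasedCovariance P s a γ h))) atTop (𝓝 0) ∧
        ∀ δ : ℝ, 0 < δ → δ < 1 →
          ∃ N : ℕ,
            IsDiscreteMixingTime (gaulPositionLaw (quadPotential S) a γ h)
              (multivariateGaussian 0 (biasedCovariance P s a γ h)) δ N ∧
            (N : ℝ) ≤ C * ((Real.log κ + Real.log (1 / δ) + Real.log d) /
              (1 / κ + 1 / √(κ * s₁))) := by
  -- `1000 = 25 * 40`: `log_prefactor_le` and rounding up give `25 L / (h t / 4)` steps, and the
  -- denominator of the claim is at most `2 t / s₁ = 40 * (h t / 4)`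
  refine ⟨1000, by norm_num, ?_⟩
  intro d hd S P s s₁ sd κ a γ h hS hP hSP hs hs1 hsd h1s hsd1 hgap hκ ha hγ hh
  subst ha
  have hspos := eigenvalues_pos hS hP hSP
  have hsd0 : 0 < sd := hsd ▸ hspos _
  obtain ⟨t, ht⟩ : ∃ t, t = √sd := ⟨_, rfl⟩
  have ht0 : 0 < t := ht ▸ Real.sqrt_pos.2 hsd0
  have ht2 : t ^ 2 = sd := by rw [ht, Real.sq_sqrt hsd0.le]
  have ht1 : t < 1 := by nlinarith
  rw [← ht] at hγ hgap
  have hs4 : 4 ≤ s₁ := by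
    have h1 := Real.sq_sqrt (show 0 ≤ s₁ by linarith)
    nlinarith
  have H : ∀ i, CriticalDamping t s₁ (s i) γ h := fun i =>
    { pos := ht0
      lt_one := ht1
      four_le := hs4
      sq_le := by
        rw [ht2, hsd]
        exact hs (by rw [Fin.le_def]; have := i.2; simp only; omega)
      le := by
        rw [hs1]
        exact hs (by rw [Fin.le_def]; exact Nat.zero_le _)
      friction := by rw [ht2]; exact hγ
      step := hh }
  have hκt : κ = s₁ / t ^ 2 := by rw [hκ, ht2]
  have hκ4 : 4 ≤ κ := by
    rw [hκ, le_div_iff₀ hsd0]; nlinarith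
  have hκ0 : 0 < κ := by linarith
  have hd1 : (1 : ℝ) ≤ d := by exact_mod_cast hd
  have hh0 : 0 < h := (H ⟨0, hd⟩).step_pos
  have hh1 : h ≤ 1 / 20 := (H ⟨0, hd⟩).step_le
  have he0 : 0 < h * t / 4 := by positivity
  have hTV := fun k => tvDist_gaulPositionLaw_le hd hS.isHermitian hP hSP H k
  rw [← hκt] at hTV
  have hA : 0 < 8 * (d : ℝ) * (10 ^ 7 * κ ^ 4) := by positivity
  simp only [← mul_assoc (8 * (d : ℝ))] at hTV
  simp only [mul_assoc (8 * (d : ℝ)) (10 ^ 7) (κ ^ 4)] at hTV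
  refine ⟨posDef_conj_diagonal hP fun i =>
    (one_div_pos.2 (H i).s_pos).trans_le (H i).inv_le_biasedVariance, ?_, ?_⟩
  · have hlim : Tendsto (fun k : ℕ =>
        8 * (d : ℝ) * (10 ^ 7 * κ ^ 4) * Real.exp (-(h * t / 4 * k))) atTop (𝓝 0) := by
      have h1 : Tendsto (fun k : ℕ => h * t / 4 * (k : ℝ)) atTop atTop :=
        tendsto_natCast_atTop_atTop.const_mul_atTop he0
      simpa using (Real.tendsto_exp_neg_atTop_nhds_zero.comp h1).const_mul
        (8 * (d : ℝ) * (10 ^ 7 * κ ^ 4))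
    refine tendsto_of_tendsto_of_tendsto_of_le_of_le' tendsto_const_nhds hlim
      (Eventually.of_forall fun k => tvDist_nonneg _ _) ?_
    filter_upwards [hlim.eventually (eventually_le_nhds one_pos)] with k hk using hTV k hk
  · intro δ hδ hδ1
    obtain ⟨hL1, hL⟩ := log_prefactor_le hd1 hκ4 hδ hδ1
    set L := Real.log κ + Real.log (1 / δ) + Real.log d with hLdef
    set K := ⌈Real.log (8 * d * (10 ^ 7 * κ ^ 4) / δ) / (h * t / 4)⌉₊ with hK
    have hKδ := mul_exp_neg_le_of_log_div_le hA he0 hδ (Nat.le_ceil _)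
    have hmem : K ∈ {k : ℕ | tvDist (gaulPositionLaw (quadPotential S) 1 γ h k)
        (multivariateGaussian 0 (biasedCovariance P s 1 γ h)) ≤ δ} :=
      (hTV K (hKδ.trans hδ1.le)).trans hKδ
    refine ⟨sInf _, ⟨Nat.sInf_mem ⟨K, hmem⟩, fun _ hm => Nat.sInf_le hm⟩, ?_⟩
    have hNK : ((sInf {k : ℕ | tvDist (gaulPositionLaw (quadPotential S) 1 γ h k)
        (multivariateGaussian 0 (biasedCovariance P s 1 γ h)) ≤ δ} : ℕ) : ℝ) ≤ K := by
      exact_mod_cast Nat.sInf_le hmem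
    refine hNK.trans ?_
    have hsqrt : √(κ * s₁) = s₁ / t := by
      rw [hκt, show s₁ / t ^ 2 * s₁ = (s₁ / t) ^ 2 by ring, Real.sqrt_sq (by positivity)]
    have hden : 1 / κ + 1 / √(κ * s₁) ≤ 2 * t / s₁ := by
      rw [hsqrt, hκt, one_div_div, one_div_div, ← add_div]
      gcongr
      nlinarith
    have hden0 : 0 < 1 / κ + 1 / √(κ * s₁) := by
      rw [hsqrt]; positivity
    have he1 : h * t / 4 ≤ 1 := by nlinarith
    have hA1 : 1 ≤ 8 * (d : ℝ) * (10 ^ 7 * κ ^ 4) / δ := by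
      rw [le_div_iff₀ hδ]
      have : 1 ≤ κ ^ 4 := one_le_pow₀ (by linarith)
      nlinarith
    calc (K : ℝ) ≤ Real.log (8 * d * (10 ^ 7 * κ ^ 4) / δ) / (h * t / 4) + 1 :=
          (Nat.ceil_lt_add_one (div_nonneg (Real.log_nonneg hA1) he0.le)).le
      _ ≤ 24 * L / (h * t / 4) + L / (h * t / 4) := by
          gcongr
          rw [le_div_iff₀ he0]
          linarith
      _ = 1000 * (L / (2 * t / s₁)) := by
          rw [hh]; field_simp; norm_num
      _ ≤ 1000 * (L / (1 / κ + 1 / √(κ * s₁))) := by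
          gcongr
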